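/- Let $n\ge 1$, $\alpha,\beta\in(0,1)$ and $\max\{\alpha,\beta\}<\gamma<\min\{1,\alpha+\beta\}$. For $k\in\{0,1\}$ and $s\in(0,1)$ let $\mathrm{C}^{k+s}(\mathbb{T}^n)$ be the space of functions $f:\mathbb{R}^n\to\mathbb{R}$ of class $\mathrm{C}^k$ that are $2\pi$-periodic in each variable and have finite norm $$\|f\|_{k+s}=\max_{|\mu|=k}\ \sup_{x\ne y}\frac{|\partial^\mu f(x)-\partial^\mu f(y)|}{|x-y|^s}+\max_{|\mu|\le k}\|\partial^\mu f\|_0,$$ where $\|\cdot\|_0$ is the supremum norm, and let $\mathrm{h}^{k+s}(\mathbb{T}^n)$ be the closure in $\mathrm{C}^{k+s}(\mathbb{T}^n)$ of the smooth functions that are $2\pi$-periodic in each variable. Put $$\Phi(u)[v](x)=\frac{2}{\alpha}\,(1+|\nabla u(x)|^2)^{1/2}\int_{\mathbb{R}^n}\frac{v(x)-v(x-y)-y\cdot\nabla v(x-y)}{\big[|y|^2+(u(x)-u(x-y))^2\big]^{\frac{n+1+\alpha}{2}}}\,dy,\qquad x\in\mathbb{R}^n .$$ Let $u_0\in \mathrm{h}^{1+\beta}(\mathbb{T}^n)$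 and let $u:[0,T^+)\to \mathrm{h}^{1+\beta}(\mathbb{T}^n)$, $T^+\in(0,\infty]$, be the maximal solution of the nonlocal mean curvature flow $$\frac{du}{dt}(t)=\Phi(u(t))[u(t)],\quad t\in(0,T^+),\qquad u(0)=u_0,$$ in the regularity class $$u\in \mathrm{C}([0,T^+),\mathrm{h}^{1+\beta}(\mathbb{T}^n))\cap \mathrm{C}((0,T^+),\mathrm{h}^{1+\gamma}(\mathbb{T}^n))\cap \mathrm{C}^1((0,T^+),\mathrm{h}^{\gamma-\alpha}(\mathbb{T}^n)),$$ that is, a solution in this class on $[0,T^+)$ that does not extend to a solution in the corresponding class on a larger interval $[0,T')$. Then: (i) $\|u(t)\|_0\le\|u_0\|_0$ for all $t\in[0,T^+)$. (ii) $\|\partial_{x_i}u(t)\|_0\le\|\partial_{x_i}u_0\|_0$ for all $t\in[0,T^+)$ and $1\le i\le n$. (iii) If $\beta>\alpha$, then $u$ is differentiable in time on all of $[0,T^+)$ with respect to $\|\cdot\|_0$ (at $t=0$ from the right), and $\|\partial_t u(t)\|_0\le\|\partial_t u(0)\|_0$ for all $t\in[0,T^+)$. -/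

import Mathlib

open MeasureTheory Filter Topology
open scoped ENNReal ContDiff

noncomputable section

namespace NMCF

/-- The Euclidean space `ℝⁿ`. -/
abbrev E (n : ℕ) : Type := EuclideanSpace ℝ (Fin n)

/-- The `i`-th canonical basis vector of `ℝⁿ`. -/
def basisVec {n : ℕ} (i : Fin n) : E n := EuclideanSpace.single i 1

/-- `f` is `2π`-periodic with respect to each of its variables. -/
def TorusPeriodic {n : ℕ} (f : E n → ℝ) : Prop :=
  ∀ (i : Fin n) (x : E n), f (x + (2 * Real.pi) • basisVec i) = f x

/-- The supremum norm `‖f‖₀`, as an extended nonnegative real number. -/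
def supNorm {n : ℕ} (f : E n → ℝ) : ℝ≥0∞ := ⨆ x, ‖f x‖ₑ

/-- The first order partial derivative of `f` in the direction of `x_i`. -/
def partialDeriv {n : ℕ} (i : Fin n) (f : E n → ℝ) (x : E n) : ℝ :=
  fderiv ℝ f x (basisVec i)

/-- The partial derivative of order `m` of `f` with respect to the variables
`x_{μ 0}, …, x_{μ (m-1)}`. As `μ` varies these are all the partial derivatives of order `m`. -/
def iteratedPartial {n m : ℕ} (μ : Fin m → Fin n) (f : E n → ℝ) (x : E n) : ℝ :=
  iteratedFDeriv ℝ m f x (fun j => basisVec (μ j))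

/-- The norm of `C^{k+s}(𝕋ⁿ)`, `s ∈ (0,1)`, with value `⊤` outside this space: the maximum of the
`s`-Hölder seminorms of all partial derivatives of order `k`, plus the maximum of the supremum
norms of all partial derivatives of order at most `k`. -/
def holderNorm {n : ℕ} (k : ℕ) (s : ℝ) (f : E n → ℝ) : ℝ≥0∞ :=
  (⨆ μ : Fin k → Fin n, eHolderNorm s.toNNReal (iteratedPartial μ f)) +
    ⨆ (m : ℕ) (_ : m ≤ k) (μ : Fin m → Fin n), supNorm (iteratedPartial μ f)

/-- The Hölder space `C^{k+s}(𝕋ⁿ)`, `s ∈ (0,1)`. -/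
def holderSpace (n k : ℕ) (s : ℝ) : Set (E n → ℝ) :=
  {f | TorusPeriodic f ∧ ContDiff ℝ k f ∧ holderNorm k s f < ⊤}

/-- The little Hölder space `h^{k+s}(𝕋ⁿ)`, `s ∈ (0,1)`: the closure of the smooth functions
`C^∞(𝕋ⁿ)` in `C^{k+s}(𝕋ⁿ)`. -/
def littleHolder (n k : ℕ) (s : ℝ) : Set (E n → ℝ) :=
  {f | f ∈ holderSpace n k s ∧
    ∀ ε : ℝ≥0∞, 0 < ε →
      ∃ g : E n → ℝ, TorusPeriodic g ∧ ContDiff ℝ ∞ g ∧ holderNorm k s (f - g) < ε}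

/-- The curve `u` restricted to the set of times `I` takes its values in the little Hölder space
`h^{k+s}(𝕋ⁿ)` and is continuous with respect to the norm of that space, i.e.
`u ∈ C(I, h^{k+s}(𝕋ⁿ))`. -/
def ContinuousInto {n : ℕ} (k : ℕ) (s : ℝ) (I : Set ℝ) (u : ℝ → E n → ℝ) : Prop :=
  (∀ t ∈ I, u t ∈ littleHolder n k s) ∧
    ∀ t ∈ I, Tendsto (fun r => holderNorm k s (u r - u t)) (𝓝[I] t) (𝓝 0)

/-- At the time `t`, the difference quotients of the curve `u` at times in `I` converge to the
function `w` in the norm `N`. At an endpoint of `I` this is a one-sided derivative. -/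
def HasTimeDeriv {n : ℕ} (N : (E n → ℝ) → ℝ≥0∞) (I : Set ℝ) (u : ℝ → E n → ℝ)
    (w : E n → ℝ) (t : ℝ) : Prop :=
  Tendsto (fun r => N ((r - t)⁻¹ • (u r - u t) - w)) (𝓝[I \ {t}] t) (𝓝 0)

/-- `u ∈ C¹(I, h^{k+s}(𝕋ⁿ))`, with derivative `w`. -/
def ContDiffOneInto {n : ℕ} (k : ℕ) (s : ℝ) (I : Set ℝ) (u w : ℝ → E n → ℝ) : Prop :=
  ContinuousInto k s I u ∧ ContinuousInto k s I w ∧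
    ∀ t ∈ I, HasTimeDeriv (holderNorm k s) I u (w t) t

/-- The operator
`Φ(u)[v](x) = (2/α) (1+|∇u(x)|²)^{1/2}`
`  ∫ (v(x) - v(x-y) - y·∇v(x-y)) / (|y|² + (u(x)-u(x-y))²)^{(n+1+α)/2} dy`. -/
def Phi {n : ℕ} (α : ℝ) (u v : E n → ℝ) (x : E n) : ℝ :=
  2 / α * Real.sqrt (1 + ‖gradient u x‖ ^ 2) *
    ∫ y : E n, (v x - v (x - y) - inner ℝ y (gradient v (x - y))) /
      (‖y‖ ^ 2 + (u x - u (x - y)) ^ 2) ^ (((n : ℝ) + 1 + α) / 2)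

/-- The interval of times `[0,T)`, with `T` possibly infinite. -/
def timeIco (T : EReal) : Set ℝ := {t | 0 ≤ t ∧ (t : EReal) < T}

/-- The interval of times `(0,T)`, with `T` possibly infinite. -/
def timeIoo (T : EReal) : Set ℝ := {t | 0 < t ∧ (t : EReal) < T}

/-- `u` (restricted to `[0,T)`) is a solution on `[0,T)` of the evolution problem
`du/dt(t) = Φ(u(t))[u(t)]`, `t > 0`, `u(0) = u₀`, with the regularity
`u ∈ C([0,T), h^{1+β}) ∩ C((0,T), h^{1+γ}) ∩ C¹((0,T), h^{γ-α})`. -/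
structure IsSolution {n : ℕ} (α β γ : ℝ) (u₀ : E n → ℝ) (T : EReal) (u : ℝ → E n → ℝ) :
    Prop where
  pos : 0 < T
  continuous_zero : ContinuousInto 1 β (timeIco T) u
  continuous_pos : ContinuousInto 1 γ (timeIoo T) u
  equation : ∃ w : ℝ → E n → ℝ, ContDiffOneInto 0 (γ - α) (timeIoo T) u w ∧
    ∀ t ∈ timeIoo T, w t = Phi α (u t) (u t)
  initial : u 0 = u₀

/-- `u` is a maximal solution, with maximal existence time `T`: it is a solution on `[0,T)`, and
it does not extend to a solution on a larger interval `[0,T')`. -/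
structure IsMaximalSolution {n : ℕ} (α β γ : ℝ) (u₀ : E n → ℝ) (T : EReal)
    (u : ℝ → E n → ℝ) : Prop where
  isSolution : IsSolution α β γ u₀ T u
  maximal : ∀ (T' : EReal) (v : ℝ → E n → ℝ), IsSolution α β γ u₀ T' v → T ≤ T' →
    (∀ t ∈ timeIco T, v t = u t) → T' = T

end NMCF

end

/-! Everything rests on a comparison principle. Write y = rθ with |θ| = 1 and q(r) = (u(x) - u(x -
rθ))/r. The numerator in Φ(u)[u](x) is -r² q'(r), and the denominator is r^{n+1+α}(1 + q²)^p with p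
= (n+1+α)/2. Along each ray the integrand, Jacobian r^{n-1} included, is therefore -r^{-α}
(F∘q)'(r), where F' = (1 + q²)^{-p} (`pow_mul_numer_div_denom`). If u - v is maximal at x, then
∇u(x) = ∇v(x) and q_u ≥ q_v, so D = F(q_u) - F(q_v) is nonnegative and O(r^s) with s > α.
Integration by parts gives ∫ r^{-α} D' ≥ 0, that is, Φ(u)[u](x) ≤ Φ(v)[v](x) (`Phi_le_Phi`).

The parabolic maximum principle on the compact torus then shows that an upper bound for u - v at
time 0 persists for any two flows (`IsClassicalFlow.sub_le`). Comparing u with 0, with its space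
translates and with its time shifts, and dividing by the size of the shift in the last two cases,
yields (i), (ii) and (iii). For (iii) the time derivative at t = 0 is also needed. It comes from the
mean value theorem in time and from the local Lipschitz continuity of Φ from C^{1+β} to bounded
functions for β > α (`abs_Phi_sub_le`). -/

noncomputable section

namespace NMCF

/-! ### Functions with Hölder continuous gradient -/

/-- `u` is continuously differentiable, and its gradient is bounded by `M` and `s`-Hölder
continuous with constant `M`. -/
structure HolderBound {n : ℕ} (s M : ℝ) (u : E n → ℝ) : Prop where
  contDiff : ContDiff ℝ 1 u
  norm_le : ∀ x, ‖fderiv ℝ u x‖ ≤ M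
  norm_sub_le : ∀ x y, ‖fderiv ℝ u x - fderiv ℝ u y‖ ≤ M * ‖x - y‖ ^ s

lemma inner_gradient_eq {n : ℕ} (u : E n → ℝ) (x y : E n) :
    inner ℝ y (gradient u x) = fderiv ℝ u x y := by
  rw [inner_gradient_right]; simp

lemma norm_gradient_eq {n : ℕ} (u : E n → ℝ) (x : E n) :
    ‖gradient u x‖ = ‖fderiv ℝ u x‖ := by
  rw [gradient]; simp

namespace HolderBound

variable {n : ℕ} {s M M' : ℝ} {u v : E n → ℝ}

lemma nonneg (hu : HolderBound s M u) : 0 ≤ M := (norm_nonneg _).trans (hu.norm_le 0)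

lemma differentiable (hu : HolderBound s M u) : Differentiable ℝ u :=
  hu.contDiff.differentiable one_ne_zero

lemma mono (hu : HolderBound s M u) (h : M ≤ M') : HolderBound s M' u where
  contDiff := hu.contDiff
  norm_le x := (hu.norm_le x).trans h
  norm_sub_le x y := (hu.norm_sub_le x y).trans (by gcongr)

lemma sub (hu : HolderBound s M u) (hv : HolderBound s M' v) :
    HolderBound s (M + M') (u - v) where
  contDiff := hu.contDiff.sub hv.contDiff
  norm_le x := by
    rw [fderiv_sub (hu.differentiable x) (hv.differentiable x)]
    exact (_root_.norm_sub_le _ _).trans (add_le_add (hu.norm_le x) (hv.norm_le x))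
  norm_sub_le x y := by
    rw [fderiv_sub (hu.differentiable x) (hv.differentiable x),
      fderiv_sub (hu.differentiable y) (hv.differentiable y), sub_sub_sub_comm, add_mul]
    exact (_root_.norm_sub_le _ _).trans (add_le_add (hu.norm_sub_le x y) (hv.norm_sub_le x y))

lemma add (hu : HolderBound s M u) (hv : HolderBound s M' v) :
    HolderBound s (M + M') (u + v) where
  contDiff := hu.contDiff.add hv.contDiff
  norm_le x := by
    rw [fderiv_add (hu.differentiable x) (hv.differentiable x)]
    exact (norm_add_le _ _).trans (add_le_add (hu.norm_le x) (hv.norm_le x))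
  norm_sub_le x y := by
    rw [fderiv_add (hu.differentiable x) (hv.differentiable x),
      fderiv_add (hu.differentiable y) (hv.differentiable y), add_sub_add_comm, add_mul]
    exact (norm_add_le _ _).trans (add_le_add (hu.norm_sub_le x y) (hv.norm_sub_le x y))

lemma abs_sub_le (hu : HolderBound s M u) (a b : E n) : |u b - u a| ≤ M * ‖b - a‖ := by
  have := (convex_univ (𝕜 := ℝ) (E := E n)).norm_image_sub_le_of_norm_fderiv_le (f := u) (C := M)
    (fun x _ => hu.differentiable x) (fun x _ => hu.norm_le x) (Set.mem_univ a) (Set.mem_univ b)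
  simpa using this

lemma abs_taylor_le (hs : 0 ≤ s) (hu : HolderBound s M u) (a b : E n) :
    |u b - u a - fderiv ℝ u a (b - a)| ≤ M * ‖b - a‖ ^ (1 + s) := by
  rcases eq_or_ne b a with rfl | hne
  · simp; exact mul_nonneg hu.nonneg (by positivity)
  have hpos : 0 < ‖b - a‖ := norm_pos_iff.2 (sub_ne_zero.2 hne)
  have := (convex_segment a b).norm_image_sub_le_of_norm_hasFDerivWithin_le' (f := u)
    (φ := fderiv ℝ u a) (C := M * ‖b - a‖ ^ s)
    (fun x _ => (hu.differentiable x).hasFDerivAt.hasFDerivWithinAt) (fun x hx => ?_)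
    (left_mem_segment ℝ a b) (right_mem_segment ℝ a b)
  · rw [Real.rpow_add hpos, Real.rpow_one]
    simpa [mul_assoc, mul_comm, mul_left_comm] using this
  · refine (hu.norm_sub_le x a).trans ?_
    gcongr
    · exact hu.nonneg
    · obtain ⟨θ, ⟨h0, h1⟩, rfl⟩ := (segment_eq_image' ℝ a b) ▸ hx
      simp only [add_sub_cancel_left, norm_smul, Real.norm_eq_abs, abs_of_nonneg h0]
      exact mul_le_of_le_one_left hpos.le h1

end HolderBound

/-! ### Absolute convergence of the integral defining Φ -/

/-- The numerator in the integrand of `Phi`. -/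
def numer {n : ℕ} (v : E n → ℝ) (x y : E n) : ℝ :=
  v x - v (x - y) - inner ℝ y (gradient v (x - y))

/-- The denominator in the integrand of `Phi`. -/
def denom {n : ℕ} (α : ℝ) (u : E n → ℝ) (x y : E n) : ℝ :=
  (‖y‖ ^ 2 + (u x - u (x - y)) ^ 2) ^ (((n : ℝ) + 1 + α) / 2)

lemma Phi_eq {n : ℕ} (α : ℝ) (u v : E n → ℝ) (x : E n) :
    Phi α u v x = 2 / α * Real.sqrt (1 + ‖gradient u x‖ ^ 2) *
      ∫ y, numer v x y / denom α u x y := rfl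

/-- The radial majorant of the integrand of `Phi`. -/
def majorant (n : ℕ) (s α r : ℝ) : ℝ := min (r ^ (1 + s)) r / r ^ ((n : ℝ) + 1 + α)

/-- The min combines the Taylor bound near 0 with the Lipschitz bound at infinity. With the Jacobian
the radial powers are r^{s-α-1} near 0, integrable since s > α, and r^{-α-1} at infinity, integrable
since α > 0. -/
lemma integrable_majorant {n : ℕ} (hn : 1 ≤ n) {s α : ℝ} (hα : 0 < α) (hs : α < s) :
    Integrable (fun y : E n => majorant n s α ‖y‖) := by
  have : Nontrivial (E n) := by
    apply Module.nontrivial_of_finrank_pos (R := ℝ); simp; omega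
  rw [integrable_fun_norm_addHaar volume (f := majorant n s α)]
  have hmeas : Measurable (majorant n s α) := by
    unfold majorant; fun_prop
  have hm : AEStronglyMeasurable (fun r : ℝ => r ^ (Module.finrank ℝ (E n) - 1) • majorant n s α r)
      := by
    apply Measurable.aestronglyMeasurable; fun_prop
  have key : ∀ r : ℝ, 0 < r → r ^ (Module.finrank ℝ (E n) - 1) • majorant n s α r =
      min (r ^ (1 + s)) r * r ^ (-2 - α) := by
    intro r hr
    rw [majorant, finrank_euclideanSpace_fin, smul_eq_mul, ← Real.rpow_natCast, Nat.cast_sub hn,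
      div_eq_mul_inv, ← Real.rpow_neg hr.le, mul_left_comm, ← Real.rpow_add hr]
    congr 2; push_cast; ring
  rw [← Set.Ioo_union_Ici_eq_Ioi (zero_lt_one' ℝ), integrableOn_union]
  constructor
  · refine Integrable.mono' ((intervalIntegral.integrableOn_Ioo_rpow_iff (s := s - α - 1)
      zero_lt_one).2 (by linarith)) hm.restrict ?_
    filter_upwards [ae_restrict_mem measurableSet_Ioo] with r hr
    rw [key r hr.1, Real.norm_eq_abs, abs_of_nonneg (by have := hr.1.le; positivity),
      show s - α - 1 = (1 + s) + (-2 - α) by ring, Real.rpow_add hr.1 (1 + s)]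
    exact mul_le_mul_of_nonneg_right (min_le_left _ _) (Real.rpow_nonneg hr.1.le _)
  · rw [integrableOn_Ici_iff_integrableOn_Ioi]
    refine Integrable.mono' (integrableOn_Ioi_rpow_of_lt (a := - α - 1) (by linarith) zero_lt_one)
      hm.restrict ?_
    filter_upwards [ae_restrict_mem measurableSet_Ioi] with r (hr : 1 < r)
    have hr0 : 0 < r := by linarith
    rw [key r hr0, Real.norm_eq_abs, abs_of_nonneg (by positivity)]
    have e : r ^ (-α - 1) = r * r ^ (-2 - α) := by
      rw [show -α - 1 = 1 + (-2 - α) by ring, Real.rpow_add hr0, Real.rpow_one]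
    rw [e]
    exact mul_le_mul_of_nonneg_right (min_le_right _ _) (Real.rpow_nonneg hr0.le _)

section Integrand

variable {n : ℕ} {s α M : ℝ} {u v : E n → ℝ}

lemma abs_numer_le (hs : 0 ≤ s) (hv : HolderBound s M v) (x y : E n) :
    |numer v x y| ≤ 2 * M * min (‖y‖ ^ (1 + s)) ‖y‖ := by
  rw [numer, inner_gradient_eq]
  have h1 := hv.abs_taylor_le hs (x - y) x
  have h2 := hv.abs_sub_le (x - y) x
  rw [sub_sub_cancel] at h1 h2
  have h3 : |fderiv ℝ v (x - y) y| ≤ M * ‖y‖ :=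
    (ContinuousLinearMap.le_opNorm _ _).trans
      (mul_le_mul_of_nonneg_right (hv.norm_le _) (norm_nonneg y))
  have h4 := hv.nonneg
  have h5 : 0 ≤ M * ‖y‖ ^ (1 + s) := by positivity
  rw [mul_min_of_nonneg _ _ (by positivity)]
  refine le_min (by linarith) ?_
  calc _ ≤ |v x - v (x - y)| + |fderiv ℝ v (x - y) y| := abs_sub _ _
    _ ≤ _ := by linarith

lemma rpow_norm_le_denom (hα : 0 ≤ α) (x y : E n) :
    ‖y‖ ^ ((n : ℝ) + 1 + α) ≤ denom α u x y := by
  rw [denom, show (n : ℝ) + 1 + α = 2 * (((n : ℝ) + 1 + α) / 2) by ring,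
    Real.rpow_mul (norm_nonneg y), show (2 * (((n : ℝ) + 1 + α) / 2)) / 2 = ((n : ℝ) + 1 + α) / 2 by ring]
  refine Real.rpow_le_rpow (by positivity) ?_ (by positivity)
  rw [Real.rpow_two]
  nlinarith [sq_nonneg (u x - u (x - y))]

lemma abs_numer_div_denom_le (hα : 0 ≤ α) (hs : 0 ≤ s) (hv : HolderBound s M v) (x y : E n) :
    |numer v x y / denom α u x y| ≤ 2 * M * majorant n s α ‖y‖ := by
  rcases eq_or_ne y 0 with rfl | hy
  · have : numer v x 0 = 0 := by simp [numer]
    rw [this]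
    have h4 := hv.nonneg
    simp only [zero_div, abs_zero, majorant]; positivity
  have hy' : 0 < ‖y‖ := norm_pos_iff.2 hy
  have hd := rpow_norm_le_denom (u := u) hα x y
  rw [abs_div, abs_of_nonneg ((by positivity : (0 : ℝ) ≤ _).trans hd), majorant, ← mul_div_assoc]
  have h4 := hv.nonneg
  gcongr
  exact abs_numer_le hs hv x y

lemma continuous_numer (hv : HolderBound s M v) (x : E n) : Continuous (numer v x) := by
  have h1 := hv.contDiff.continuous
  have h2 := hv.contDiff.continuous_fderiv one_ne_zero
  have : numer v x = fun y => v x - v (x - y) - fderiv ℝ v (x - y) y := by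
    ext y; rw [numer, inner_gradient_eq]
  rw [this]
  fun_prop

lemma measurable_denom (hu : Continuous u) (x : E n) : Measurable (denom α u x) := by
  have h1 := hu.measurable
  unfold denom
  fun_prop

lemma integrable_numer_div_denom (hn : 1 ≤ n) (hα : 0 < α) (hs : α < s) (hu : Continuous u)
    (hv : HolderBound s M v) (x : E n) :
    Integrable (fun y => numer v x y / denom α u x y) :=
  ((integrable_majorant hn hα hs).const_mul (2 * M)).mono'
    ((continuous_numer hv x).measurable.div (measurable_denom hu x)).aestronglyMeasurable
    (Eventually.of_forall fun y => by
      rw [Real.norm_eq_abs]; exact abs_numer_div_denom_le hα.le (hα.trans hs).le hv x y)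

end Integrand

/-! ### Polar coordinates and one-dimensional tools -/

lemma integral_polar {n : ℕ} (hn : 1 ≤ n) {f : E n → ℝ} (hf : Integrable f) :
    ∫ y, f y = ∫ θ : Metric.sphere (0 : E n) 1, (∫ r in Set.Ioi (0 : ℝ), r ^ (n - 1) * f (r • θ.1))
      ∂(volume : Measure (E n)).toSphere := by
  have : Nontrivial (E n) := by
    apply Module.nontrivial_of_finrank_pos (R := ℝ); simp; omega
  set g : Metric.sphere (0 : E n) 1 × Set.Ioi (0 : ℝ) → ℝ := fun p => f (p.2.1 • p.1.1)
  have hg : ∀ y : ({0}ᶜ : Set (E n)), g (homeomorphUnitSphereProd (E n) y) = f y := by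
    intro y
    have : ‖y.1‖ ≠ 0 := norm_ne_zero_iff.2 y.2
    simp [g, smul_smul, this]
  have hmp := (volume : Measure (E n)).measurePreserving_homeomorphUnitSphereProd
  have hint : Integrable g ((volume : Measure (E n)).toSphere.prod
      (Measure.volumeIoiPow (Module.finrank ℝ (E n) - 1))) := by
    rw [← hmp.integrable_comp_emb (Homeomorph.measurableEmbedding _)]
    have : g ∘ homeomorphUnitSphereProd (E n) = f ∘ Subtype.val := funext hg
    rw [this, ← integrableOn_iff_comap_subtypeVal (measurableSet_singleton _).compl]
    exact hf.integrableOn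
  calc ∫ y, f y = ∫ y : ({0}ᶜ : Set (E n)), f y.1 ∂(volume.comap Subtype.val) := by
        rw [integral_subtype_comap (measurableSet_singleton _).compl f, restrict_compl_singleton]
    _ = ∫ p, g p ∂((volume : Measure (E n)).toSphere.prod
      (Measure.volumeIoiPow (Module.finrank ℝ (E n) - 1))) := by
        rw [← hmp.integral_comp (Homeomorph.measurableEmbedding _)]
        simp only [hg]
    _ = _ := by
        rw [integral_prod _ hint]
        refine integral_congr_ae (Eventually.of_forall fun θ => ?_)
        simp only [Measure.volumeIoiPow, ENNReal.ofReal]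
        rw [integral_withDensity_eq_integral_smul (by fun_prop)]
        rw [integral_subtype_comap measurableSet_Ioi
          fun r => Real.toNNReal (r ^ (Module.finrank ℝ (E n) - 1)) • f (r • θ.1)]
        refine setIntegral_congr_fun measurableSet_Ioi fun r hr => ?_
        simp only [finrank_euclideanSpace_fin]
        rw [NNReal.smul_def, Real.coe_toNNReal _ (pow_nonneg hr.out.le _), smul_eq_mul]

/-- A primitive of `τ ↦ (1 + τ²)^{-p}`. -/
def kernelPrimitive (p q : ℝ) : ℝ := ∫ τ in (0 : ℝ)..q, (1 + τ ^ 2) ^ (-p)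

lemma hasDerivAt_kernelPrimitive (p q : ℝ) :
    HasDerivAt (kernelPrimitive p) ((1 + q ^ 2) ^ (-p)) q := by
  have hc : Continuous fun τ : ℝ => (1 + τ ^ 2) ^ (-p) :=
    (by fun_prop : Continuous fun τ : ℝ => 1 + τ ^ 2).rpow_const
      fun τ => Or.inl (by positivity)
  exact intervalIntegral.integral_hasDerivAt_right (hc.intervalIntegrable _ _)
    (hc.stronglyMeasurableAtFilter _ _) hc.continuousAt

lemma kernelPrimitive_monotone (p : ℝ) : Monotone (kernelPrimitive p) :=
  monotone_of_hasDerivAt_nonneg (hasDerivAt_kernelPrimitive p) fun q => by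
    simp only [Pi.zero_apply]; positivity

lemma abs_kernelPrimitive_sub_le {p : ℝ} (hp : 0 ≤ p) (a b : ℝ) :
    |kernelPrimitive p b - kernelPrimitive p a| ≤ |b - a| := by
  have := (convex_univ (𝕜 := ℝ) (E := ℝ)).norm_image_sub_le_of_norm_hasDerivWithin_le
    (f := kernelPrimitive p) (C := 1)
    (fun x _ => (hasDerivAt_kernelPrimitive p x).hasDerivWithinAt) (fun x _ => ?_)
    (Set.mem_univ a) (Set.mem_univ b)
  · simpa using this
  · rw [Real.norm_eq_abs, abs_of_nonneg (by positivity)]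
    exact Real.rpow_le_one_of_one_le_of_nonpos (by nlinarith [sq_nonneg x]) (by linarith)

/-- Integration by parts: the bulk term α r^{-α-1} D is nonnegative, so is the boundary term at
infinity, and the one at 0 is at most C r^{s-α}, which tends to 0. -/
lemma integral_rpow_mul_deriv_nonneg {α s C : ℝ} (hα : 0 < α) (hs : α < s) {D D' : ℝ → ℝ}
    (hD : ∀ r, 0 < r → HasDerivAt D (D' r) r) (hD0 : ∀ r, 0 < r → 0 ≤ D r)
    (hDC : ∀ r, 0 < r → D r ≤ C * r ^ s) :
    0 ≤ ∫ r in Set.Ioi (0 : ℝ), r ^ (-α) * D' r := by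
  -- Without integrability the Bochner integral is 0 by convention and nothing is left to prove.
  by_cases hint : IntegrableOn (fun r : ℝ => r ^ (-α) * D' r) (Set.Ioi 0)
  swap
  · rw [integral_undef hint]
  have hC : 0 ≤ C := by simpa using (hD0 1 one_pos).trans (hDC 1 one_pos)
  have hab : ∀ a b : ℝ, 0 < a → a ≤ b → -(C * a ^ (s - α)) ≤ ∫ r in a..b, r ^ (-α) * D' r := by
    intro a b ha hle
    have hder : ∀ r, 0 < r → HasDerivAt (fun r => r ^ (-α) * D r)
        (-α * r ^ (-α - 1) * D r + r ^ (-α) * D' r) r := fun r hr =>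
      (Real.hasDerivAt_rpow_const (Or.inl hr.ne')).mul (hD r hr)
    -- Only (r^{-α} D)' ≤ r^{-α} D' is used, so integrability of (r^{-α} D)' is not needed.
    have h := intervalIntegral.sub_le_integral_of_hasDeriv_right_of_le hle
      (fun r hr => (hder r (ha.trans_le hr.1)).continuousAt.continuousWithinAt)
      (fun r hr => (hder r (ha.trans hr.1)).hasDerivWithinAt)
      (φ := fun r => r ^ (-α) * D' r)
      (hint.mono_set fun r hr => ha.trans_le hr.1)
      (fun r hr => by
        have h1 := hD0 r (ha.trans hr.1)
        have h2 : 0 ≤ r ^ (-α - 1) := Real.rpow_nonneg (ha.trans hr.1).le _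
        have := mul_nonneg (mul_nonneg hα.le h2) h1
        linarith)
    have h1 : a ^ (-α) * D a ≤ C * a ^ (s - α) := by
      rw [sub_eq_neg_add, Real.rpow_add ha, mul_left_comm]
      gcongr
      exact hDC a ha
    have h2 : 0 ≤ b ^ (-α) * D b :=
      mul_nonneg (Real.rpow_nonneg (ha.le.trans hle) _) (hD0 b (ha.trans_le hle))
    linarith
  have hlim : Tendsto (fun k : ℕ => ∫ r in ((k : ℝ) + 1)⁻¹..((k : ℝ) + 1), r ^ (-α) * D' r) atTop
      (𝓝 (∫ r in Set.Ioi (0 : ℝ), r ^ (-α) * D' r)) := by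
    have ha : Tendsto (fun k : ℕ => ((k : ℝ) + 1)⁻¹) atTop (𝓝 0) := by
      simpa using tendsto_one_div_add_atTop_nhds_zero_nat (𝕜 := ℝ)
    have hb : Tendsto (fun k : ℕ => (k : ℝ) + 1) atTop atTop :=
      tendsto_atTop_add_const_right _ _ tendsto_natCast_atTop_atTop
    have h := ((aecover_Ioi_of_Ioi (μ := volume) ha).inter
      ((aecover_Iic hb).mono Measure.restrict_le_self)).integral_tendsto_of_countably_generated hint
    refine h.congr fun k => ?_
    have hk : (0 : ℝ) ≤ k := k.cast_nonneg
    have hk' : (0 : ℝ) ≤ ((k : ℝ) + 1)⁻¹ := by positivity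
    rw [Measure.restrict_restrict (measurableSet_Ioi.inter measurableSet_Iic),
      intervalIntegral.integral_of_le
        ((inv_le_one_of_one_le₀ (by linarith)).trans (by linarith)), Set.Ioi_inter_Iic,
      Set.inter_eq_left.2 (Set.Ioc_subset_Ioi_self.trans (Set.Ioi_subset_Ioi hk'))]
  have hlim0 : Tendsto (fun k : ℕ => -(C * ((k : ℝ) + 1)⁻¹ ^ (s - α))) atTop (𝓝 0) := by
    have h1 : Tendsto (fun k : ℕ => ((k : ℝ) + 1)⁻¹) atTop (𝓝 0) := by
      simpa using tendsto_one_div_add_atTop_nhds_zero_nat (𝕜 := ℝ)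
    have h2 := ((h1.rpow_const (p := s - α) (Or.inr (by linarith))).const_mul C).neg
    rwa [Real.zero_rpow (by linarith), mul_zero, neg_zero] at h2
  refine le_of_tendsto_of_tendsto' hlim0 hlim fun k => ?_
  have : (0 : ℝ) ≤ k := k.cast_nonneg
  exact hab _ _ (by positivity) ((inv_le_one_of_one_le₀ (by linarith)).trans (by linarith))

/-! ### Comparison principle for the operator -/

section Comparison

variable {n : ℕ} {s α M M' : ℝ} {u v : E n → ℝ}

/-- The difference quotient of `u` at `x` along the ray in direction `-θ`. -/
def radialQuotient (u : E n → ℝ) (x θ : E n) (r : ℝ) : ℝ := (u x - u (x - r • θ)) / r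

lemma hasDerivAt_radialQuotient (hu : Differentiable ℝ u) (x θ : E n) {r : ℝ} (hr : 0 < r) :
    HasDerivAt (radialQuotient u x θ) (-numer u x (r • θ) / r ^ 2) r := by
  have h1 : HasDerivAt (fun r : ℝ => x - r • θ) (-θ) r := by
    simpa using ((hasDerivAt_id r).smul_const θ).const_sub x
  have h2 := ((hu (x - r • θ)).hasFDerivAt.comp_hasDerivAt r h1).const_sub (u x)
  have h3 := h2.div (hasDerivAt_id r) hr.ne'
  refine h3.congr_deriv ?_
  simp only [numer, inner_gradient_eq, map_neg, map_smul, smul_eq_mul, id_eq,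
    Function.comp_apply]
  ring

/-- By `hasDerivAt_radialQuotient` the last factor is the derivative of the quotient, so the
right-hand side is -r^{-α} times the derivative of `kernelPrimitive` composed with it. -/
lemma pow_mul_numer_div_denom (hn : 1 ≤ n) {x θ : E n} (hθ : ‖θ‖ = 1) {r : ℝ} (hr : 0 < r) :
    r ^ (n - 1) * (numer u x (r • θ) / denom α u x (r • θ)) =
      -(r ^ (-α) * ((1 + radialQuotient u x θ r ^ 2) ^ (-(((n : ℝ) + 1 + α) / 2)) *
        (-numer u x (r • θ) / r ^ 2))) := by
  have h1 : denom α u x (r • θ) = r ^ ((n : ℝ) + 1 + α) *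
      (1 + radialQuotient u x θ r ^ 2) ^ (((n : ℝ) + 1 + α) / 2) := by
    have h2 : ‖r • θ‖ ^ 2 + (u x - u (x - r • θ)) ^ 2 =
        r ^ (2 : ℝ) * (1 + radialQuotient u x θ r ^ 2) := by
      rw [norm_smul, hθ, radialQuotient, Real.norm_eq_abs, abs_of_pos hr, Real.rpow_two]
      field_simp
    rw [denom, h2, Real.mul_rpow (by positivity) (by positivity), ← Real.rpow_mul hr.le]
    congr 2; ring
  have h3 : r ^ ((n : ℝ) + 1 + α) = r ^ (n - 1) * r ^ α * r ^ 2 := by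
    rw [← Real.rpow_natCast r (n - 1), ← Real.rpow_natCast r 2, ← Real.rpow_add hr,
      ← Real.rpow_add hr, Nat.cast_sub hn]
    congr 1; push_cast; ring
  have h4 : 0 < (1 + radialQuotient u x θ r ^ 2) ^ (((n : ℝ) + 1 + α) / 2) := by positivity
  have h5 : 0 < r ^ α := by positivity
  rw [h1, h3, Real.rpow_neg hr.le, Real.rpow_neg (by positivity)]
  field_simp

/-- Comparison principle: at a maximum point of `u - v` the operator is ordered. -/
lemma Phi_le_Phi (hn : 1 ≤ n) (hα : 0 < α) (hs : α < s) (hu : HolderBound s M u)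
    (hv : HolderBound s M' v) {x : E n} (hx : ∀ z, u z - v z ≤ u x - v x) :
    Phi α u u x ≤ Phi α v v x := by
  have hmax : fderiv ℝ (u - v) x = 0 :=
    IsLocalMax.fderiv_eq_zero (Eventually.of_forall hx)
  have hgrad : ‖gradient u x‖ = ‖gradient v x‖ := by
    rw [fderiv_sub (hu.differentiable x) (hv.differentiable x), sub_eq_zero] at hmax
    rw [norm_gradient_eq, norm_gradient_eq, hmax]
  -- The gradients agree at x, hence so do the prefactors, and only the integrals remain to be
  -- compared.
  rw [Phi_eq, Phi_eq, hgrad]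
  refine mul_le_mul_of_nonneg_left ?_ (by positivity)
  have hIu := integrable_numer_div_denom hn hα hs hu.contDiff.continuous hu x
  have hIv := integrable_numer_div_denom hn hα hs hv.contDiff.continuous hv x
  have hpolar := integral_polar hn (hIu.sub hIv)
  simp only [Pi.sub_apply] at hpolar
  rw [← sub_nonpos, ← integral_sub hIu hIv, hpolar]
  refine integral_nonpos fun θ => ?_
  have hθ : ‖θ.1‖ = 1 := by simp
  set p : ℝ := ((n : ℝ) + 1 + α) / 2 with hp
  have hp0 : 0 ≤ p := by positivity
  set F := kernelPrimitive p
  set D' : ℝ → ℝ := fun r =>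
    (1 + radialQuotient u x θ r ^ 2) ^ (-p) * (-numer u x (r • θ.1) / r ^ 2) -
    (1 + radialQuotient v x θ r ^ 2) ^ (-p) * (-numer v x (r • θ.1) / r ^ 2) with hD'
  have hle : ∀ r, 0 < r → radialQuotient v x θ r ≤ radialQuotient u x θ r := by
    intro r hr
    have := hx (x - r • θ.1)
    exact div_le_div_of_nonneg_right (by linarith) hr.le
  have key : 0 ≤ ∫ r in Set.Ioi (0 : ℝ), r ^ (-α) * D' r := by
    refine integral_rpow_mul_deriv_nonneg (C := M + M') hα hs
      (D := fun r => F (radialQuotient u x θ r) - F (radialQuotient v x θ r)) ?_ ?_ ?_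
    · intro r hr
      exact ((hasDerivAt_kernelPrimitive p _).comp r
        (hasDerivAt_radialQuotient hu.differentiable x θ hr)).sub
        ((hasDerivAt_kernelPrimitive p _).comp r
        (hasDerivAt_radialQuotient hv.differentiable x θ hr))
    · exact fun r hr => sub_nonneg.2 (kernelPrimitive_monotone p (hle r hr))
    · intro r hr
      -- Since ∇(u - v)(x) = 0, Taylor's estimate bounds the increment of u - v by (M + M') r^{1+s};
      -- dividing by r gives the decay of D at 0.
      have h1 := (hu.sub hv).abs_taylor_le (hα.trans hs).le x (x - r • θ.1)
      rw [hmax, sub_sub_cancel_left, norm_neg, norm_smul, hθ, Real.norm_eq_abs, abs_of_pos hr,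
        mul_one, Real.rpow_add hr, Real.rpow_one] at h1
      have h2 := (abs_le.1 h1).1
      simp only [Pi.sub_apply, zero_apply, sub_zero] at h2
      calc _ ≤ |F (radialQuotient u x θ r) - F (radialQuotient v x θ r)| := le_abs_self _
        _ ≤ |radialQuotient u x θ r - radialQuotient v x θ r| := abs_kernelPrimitive_sub_le hp0 _ _
        _ = radialQuotient u x θ r - radialQuotient v x θ r :=
          abs_of_nonneg (sub_nonneg.2 (hle r hr))
        _ = ((u x - u (x - r • θ.1)) - (v x - v (x - r • θ.1))) / r := (sub_div _ _ _).symm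
        _ ≤ (M + M') * r ^ s := by
          rw [div_le_iff₀ hr]; linarith
  refine neg_nonneg.1 ?_
  rw [← integral_neg]
  refine key.trans_eq (setIntegral_congr_fun measurableSet_Ioi fun r hr => ?_)
  have h1 := pow_mul_numer_div_denom (α := α) (u := u) (x := x) hn hθ hr
  have h2 := pow_mul_numer_div_denom (α := α) (u := v) (x := x) hn hθ hr
  simp only [mul_sub, h1, h2, hD', ← hp]
  ring

end Comparison

/-! ### Comparison principle for the flow -/

/-- A fundamental cell of the torus. -/
def torusCell (n : ℕ) : Set (E n) :=
  WithLp.toLp 2 '' Set.univ.pi fun _ : Fin n => Set.Icc (0 : ℝ) (2 * Real.pi)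

lemma isCompact_torusCell (n : ℕ) : IsCompact (torusCell n) :=
  (isCompact_univ_pi fun _ => isCompact_Icc).image (PiLp.continuous_toLp 2 _)

lemma exists_mem_torusCell {n : ℕ} (x : E n) :
    ∃ y ∈ torusCell n, ∀ f : E n → ℝ, TorusPeriodic f → f y = f x := by
  have hπ : 0 < 2 * Real.pi := Real.two_pi_pos
  let k : Fin n → ℤ := fun i => toIcoDiv hπ 0 (x i)
  let c : E n := ∑ i, k i • ((2 * Real.pi) • basisVec i)
  have hc : ∀ i, c i = k i * (2 * Real.pi) := by
    intro i
    simp [c, basisVec, Finset.sum_apply, Pi.single_apply, mul_comm]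
  refine ⟨x - c, ⟨fun i => x i - c i, ?_, rfl⟩, fun f hf => ?_⟩
  · intro i _
    have h := toIcoMod_mem_Ico hπ 0 (x i)
    rw [← self_sub_toIcoDiv_zsmul, zero_add, zsmul_eq_mul, ← hc i] at h
    exact Set.Ico_subset_Icc_self h
  · have : Function.Periodic f c := by
      refine Finset.sum_induction _ (Function.Periodic f) (fun _ _ h1 h2 => h1.add_period h2)
        (fun z => by simp) fun i _ => Function.Periodic.zsmul (hf i) (k i)
    exact this.sub_eq x

/-- `u` solves the flow classically on `(0, τ]` and is continuous up to the time `0`. -/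
structure IsClassicalFlow {n : ℕ} (α s τ : ℝ) (u : ℝ → E n → ℝ) : Prop where
  continuousOn : ContinuousOn (fun p : ℝ × E n => u p.1 p.2) (Set.Icc 0 τ ×ˢ Set.univ)
  periodic : ∀ t ∈ Set.Icc 0 τ, TorusPeriodic (u t)
  holderBound : ∀ t ∈ Set.Ioc 0 τ, ∃ M, HolderBound s M (u t)
  hasDerivWithinAt : ∀ t ∈ Set.Ioc 0 τ, ∀ x,
    HasDerivWithinAt (fun r => u r x) (Phi α (u t) (u t) x) (Set.Icc 0 t) t

/-- Slopes from the left are nonnegative at a maximum. The left derivative suffices, so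
`IsClassicalFlow` involves no times beyond τ. -/
lemma nonneg_of_hasDerivWithinAt_Icc {f : ℝ → ℝ} {f' t : ℝ} (ht : 0 < t)
    (hf : HasDerivWithinAt f f' (Set.Icc 0 t) t) (hmax : ∀ r ∈ Set.Icc 0 t, f r ≤ f t) :
    0 ≤ f' := by
  have h1 : Tendsto (slope f t) (𝓝[Set.Ioo 0 t] t) (𝓝 f') := by
    have := hasDerivWithinAt_iff_tendsto_slope.1 hf
    refine this.mono_left (nhdsWithin_mono _ fun r hr => ⟨⟨hr.1.le, hr.2.le⟩, hr.2.ne⟩)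
  have : (𝓝[Set.Ioo 0 t] t).NeBot := right_nhdsWithin_Ioo_neBot ht
  refine ge_of_tendsto h1 ?_
  filter_upwards [self_mem_nhdsWithin] with r hr
  rw [slope_def_field]
  exact div_nonneg_of_nonpos (by linarith [hmax r ⟨hr.1.le, hr.2.le⟩]) (by linarith [hr.2])

/-- Comparison principle for the flow. -/
lemma IsClassicalFlow.sub_le {n : ℕ} (hn : 1 ≤ n) {α s τ : ℝ} (hα : 0 < α) (hs : α < s)
    {u v : ℝ → E n → ℝ} (hu : IsClassicalFlow α s τ u) (hv : IsClassicalFlow α s τ v) {C : ℝ}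
    (h0 : ∀ x, u 0 x - v 0 x ≤ C) {t : ℝ} (ht : t ∈ Set.Icc 0 τ) (x : E n) :
    u t x - v t x ≤ C := by
  -- The penalty εt makes the inequality strict: at a maximum with positive time, the time
  -- derivative would be both nonnegative and at most -ε.
  have key : ∀ ε > 0, u t x - v t x ≤ C + ε * t := by
    intro ε hε
    set φ : ℝ × E n → ℝ := fun p => u p.1 p.2 - v p.1 p.2 - ε * p.1 with hφ
    have hφc : ContinuousOn φ (Set.Icc 0 τ ×ˢ torusCell n) :=
      ((hu.continuousOn.sub hv.continuousOn).mono
        (Set.prod_mono_right (Set.subset_univ _))).sub (by fun_prop)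
    -- Periodicity turns the maximum over the compact cell into a maximum over all of ℝⁿ, as
    -- `Phi_le_Phi` requires.
    have hper : ∀ r ∈ Set.Icc 0 τ, ∀ z, ∃ y ∈ torusCell n, φ (r, y) = φ (r, z) := by
      intro r hr z
      obtain ⟨y, hy, h⟩ := exists_mem_torusCell z
      exact ⟨y, hy, by simp only [hφ, h _ (hu.periodic r hr), h _ (hv.periodic r hr)]⟩
    obtain ⟨x', hx', -⟩ := hper t ht x
    obtain ⟨⟨t₀, x₀⟩, ⟨ht₀, hx₀⟩, hmax⟩ :=
      (isCompact_Icc.prod (isCompact_torusCell n)).exists_isMaxOn ⟨(t, x'), ht, hx'⟩ hφc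
    have hmax' : ∀ r ∈ Set.Icc 0 τ, ∀ z, φ (r, z) ≤ φ (t₀, x₀) := by
      intro r hr z
      obtain ⟨y, hy, h⟩ := hper r hr z
      rw [← h]
      exact hmax (Set.mk_mem_prod hr hy)
    rcases ht₀.1.eq_or_lt with h00 | hpos
    · have h1 := hmax' t ht x
      have h2 := h0 x₀
      subst h00
      simp only [hφ, mul_zero, sub_zero] at h1
      linarith
    · exfalso
      have ht₀' : t₀ ∈ Set.Ioc 0 τ := ⟨hpos, ht₀.2⟩
      obtain ⟨M, hM⟩ := hu.holderBound t₀ ht₀'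
      obtain ⟨M', hM'⟩ := hv.holderBound t₀ ht₀'
      have h1 : Phi α (u t₀) (u t₀) x₀ ≤ Phi α (v t₀) (v t₀) x₀ := by
        refine Phi_le_Phi hn hα hs hM hM' fun z => ?_
        have := hmax' t₀ ht₀ z
        simp only [hφ] at this
        linarith
      have h2 := ((hu.hasDerivWithinAt t₀ ht₀' x₀).sub (hv.hasDerivWithinAt t₀ ht₀' x₀)).sub
        ((hasDerivWithinAt_id t₀ (Set.Icc 0 t₀)).const_mul ε)
      have h3 := nonneg_of_hasDerivWithinAt_Icc hpos h2 fun r hr =>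
        hmax' r ⟨hr.1, hr.2.trans ht₀.2⟩ x₀
      linarith
  have hlim : Tendsto (fun ε => C + ε * t) (𝓝[>] (0 : ℝ)) (𝓝 C) := by
    have : Tendsto (fun ε => C + ε * t) (𝓝 (0 : ℝ)) (𝓝 (C + 0 * t)) := by
      apply Continuous.tendsto; fun_prop
    rw [zero_mul, add_zero] at this
    exact this.mono_left nhdsWithin_le_nhds
  exact ge_of_tendsto hlim (by filter_upwards [self_mem_nhdsWithin] with ε hε using key ε hε)

/-! ### The zero flow and invariance under translations in space and time -/

lemma isClassicalFlow_zero {n : ℕ} (α s τ : ℝ) :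
    IsClassicalFlow α s τ (fun _ _ => 0 : ℝ → E n → ℝ) where
  continuousOn := continuousOn_const
  periodic _ _ _ _ := rfl
  holderBound _ _ := ⟨0, contDiff_const, by simp, by simp⟩
  hasDerivWithinAt t _ x := by
    have : Phi α (fun _ : E n => (0 : ℝ)) (fun _ => 0) x = 0 := by
      simp [Phi_eq, numer, gradient_fun_const]
    rw [this]
    exact hasDerivWithinAt_const _ _ _

lemma Phi_translate {n : ℕ} (α : ℝ) (u : E n → ℝ) (h x : E n) :
    Phi α (fun z => u (z + h)) (fun z => u (z + h)) x = Phi α u u (x + h) := by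
  have hgrad : ∀ z, gradient (fun z => u (z + h)) z = gradient u (z + h) := by
    intro z
    simp only [gradient, fderiv_comp_add_right]
  simp only [Phi, hgrad, sub_add_eq_add_sub]

lemma HolderBound.translate {n : ℕ} {s M : ℝ} {u : E n → ℝ} (hu : HolderBound s M u) (h : E n) :
    HolderBound s M (fun z => u (z + h)) where
  contDiff := hu.contDiff.comp (contDiff_id.add contDiff_const)
  norm_le x := by rw [fderiv_comp_add_right]; exact hu.norm_le _
  norm_sub_le x y := by
    rw [fderiv_comp_add_right, fderiv_comp_add_right]
    simpa using hu.norm_sub_le (x + h) (y + h)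

lemma IsClassicalFlow.space_translate {n : ℕ} {α s τ : ℝ} {u : ℝ → E n → ℝ}
    (hu : IsClassicalFlow α s τ u) (h : E n) :
    IsClassicalFlow α s τ (fun t x => u t (x + h)) where
  continuousOn := hu.continuousOn.comp (f := fun p : ℝ × E n => (p.1, p.2 + h)) (by fun_prop)
    fun p hp => ⟨hp.1, trivial⟩
  periodic t ht i x := by
    have := hu.periodic t ht i (x + h)
    rwa [add_right_comm] at this
  holderBound t ht := (hu.holderBound t ht).imp fun _ hM => hM.translate h
  hasDerivWithinAt t ht x := by
    rw [Phi_translate]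
    exact hu.hasDerivWithinAt t ht (x + h)

lemma IsClassicalFlow.time_translate {n : ℕ} {α s τ : ℝ} {u : ℝ → E n → ℝ} {h : ℝ}
    (h0 : 0 ≤ h) (hu : IsClassicalFlow α s (τ + h) u) :
    IsClassicalFlow α s τ (fun t x => u (t + h) x) where
  continuousOn := hu.continuousOn.comp (f := fun p : ℝ × E n => (p.1 + h, p.2)) (by fun_prop)
    fun p hp => ⟨⟨add_nonneg hp.1.1 h0, add_le_add_left hp.1.2 h⟩, trivial⟩
  periodic t ht := hu.periodic _ ⟨add_nonneg ht.1 h0, add_le_add_left ht.2 h⟩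
  holderBound t ht := hu.holderBound _ ⟨by linarith [ht.1], add_le_add_left ht.2 h⟩
  hasDerivWithinAt t ht x := by
    have h1 := hu.hasDerivWithinAt (t + h) ⟨by linarith [ht.1], add_le_add_left ht.2 h⟩ x
    have h2 := h1.scomp t (h := fun r => r + h) ((hasDerivWithinAt_id t (Set.Icc 0 t)).add_const h)
      fun r hr => ⟨add_nonneg hr.1 h0, add_le_add_left hr.2 h⟩
    rw [one_smul] at h2
    exact h2

lemma IsClassicalFlow.mono {n : ℕ} {α s τ τ' : ℝ} {u : ℝ → E n → ℝ}
    (hu : IsClassicalFlow α s τ u) (h : τ' ≤ τ) : IsClassicalFlow α s τ' u where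
  continuousOn := hu.continuousOn.mono (Set.prod_mono_left (Set.Icc_subset_Icc_right h))
  periodic t ht := hu.periodic t (Set.Icc_subset_Icc_right h ht)
  holderBound t ht := hu.holderBound t (Set.Ioc_subset_Ioc_right h ht)
  hasDerivWithinAt t ht := hu.hasDerivWithinAt t (Set.Ioc_subset_Ioc_right h ht)

/-! ### From the norms and time derivatives of the statement to pointwise estimates -/

lemma supNorm_le_ofReal_iff {n : ℕ} {f : E n → ℝ} {C : ℝ} (hC : 0 ≤ C) :
    supNorm f ≤ ENNReal.ofReal C ↔ ∀ x, |f x| ≤ C := by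
  simp only [supNorm, iSup_le_iff, Real.enorm_eq_ofReal_abs, ENNReal.ofReal_le_ofReal_iff hC]

lemma supNorm_le_supNorm {n m : ℕ} {f : E n → ℝ} {g : E m → ℝ}
    (h : ∀ C, 0 ≤ C → (∀ x, |g x| ≤ C) → ∀ x, |f x| ≤ C) : supNorm f ≤ supNorm g := by
  rcases eq_or_ne (supNorm g) ⊤ with htop | htop
  · simp [htop]
  have hg := ENNReal.ofReal_toReal htop
  rw [← hg, supNorm_le_ofReal_iff ENNReal.toReal_nonneg]
  exact h _ ENNReal.toReal_nonneg ((supNorm_le_ofReal_iff ENNReal.toReal_nonneg).1 hg.ge)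

lemma tendsto_supNorm_iff {n : ℕ} {ι : Type*} {l : Filter ι} {f : ι → E n → ℝ} :
    Tendsto (fun i => supNorm (f i)) l (𝓝 0) ↔ ∀ ε : ℝ, 0 < ε → ∀ᶠ i in l, ∀ x, |f i x| ≤ ε := by
  rw [ENNReal.tendsto_nhds_zero]
  constructor
  · intro h ε hε
    filter_upwards [h (ENNReal.ofReal ε) (ENNReal.ofReal_pos.2 hε)] with i hi
    exact (supNorm_le_ofReal_iff hε.le).1 hi
  · intro h ε hε
    rcases eq_or_ne ε ⊤ with rfl | htop
    · simp
    have hpos := ENNReal.toReal_pos hε.ne' htop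
    filter_upwards [h ε.toReal hpos] with i hi
    rw [← ENNReal.ofReal_toReal htop]
    exact (supNorm_le_ofReal_iff hpos.le).2 hi

lemma supNorm_iteratedPartial_le_holderNorm {n k m : ℕ} (hm : m ≤ k) (s : ℝ) (μ : Fin m → Fin n)
    (f : E n → ℝ) : supNorm (iteratedPartial μ f) ≤ holderNorm k s f := by
  refine le_trans ?_ le_add_self
  exact le_iSup₂_of_le m hm (le_iSup (fun μ : Fin m → Fin n => supNorm (iteratedPartial μ f)) μ)

lemma supNorm_le_holderNorm {n : ℕ} (k : ℕ) (s : ℝ) (f : E n → ℝ) :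
    supNorm f ≤ holderNorm k s f := by
  have : iteratedPartial (Fin.elim0 : Fin 0 → Fin n) f = f := by
    ext x; simp [iteratedPartial]
  simpa [this] using supNorm_iteratedPartial_le_holderNorm k.zero_le s (Fin.elim0 : Fin 0 → Fin n) f

/-- This is the source of the factor n in later bounds: the partial derivatives are summed crudely,
using |x_i| ≤ ‖x‖. -/
lemma norm_le_of_abs_basisVec_le {n : ℕ} (φ : E n →L[ℝ] ℝ) {C : ℝ} (hC : 0 ≤ C)
    (h : ∀ i, |φ (basisVec i)| ≤ C) : ‖φ‖ ≤ n * C := by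
  refine φ.opNorm_le_bound (by positivity) fun x => ?_
  have hx : x = ∑ i, x i • basisVec i := by
    ext j
    simp [basisVec, Finset.sum_apply, Pi.single_apply]
  calc ‖φ x‖ = ‖∑ i, x i * φ (basisVec i)‖ := by
        conv_lhs => rw [hx]
        simp
    _ ≤ ∑ i, ‖x i * φ (basisVec i)‖ := norm_sum_le _ _
    _ ≤ ∑ _i : Fin n, ‖x‖ * C := by
        refine Finset.sum_le_sum fun i _ => ?_
        rw [norm_mul]
        exact mul_le_mul (PiLp.norm_apply_le x i) (h i) (norm_nonneg _) (norm_nonneg _)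
    _ = n * C * ‖x‖ := by simp; ring

lemma holderBound_of_holderNorm_le {n : ℕ} {s C : ℝ} (hs : 0 ≤ s) (hC : 0 ≤ C) {f : E n → ℝ}
    (hf : ContDiff ℝ 1 f) (h : holderNorm 1 s f ≤ ENNReal.ofReal C) : HolderBound s (n * C) f := by
  have hpart : ∀ i : Fin n, iteratedPartial (fun _ : Fin 1 => i) f =
      fun x => fderiv ℝ f x (basisVec i) := by
    intro i; ext x
    simp [iteratedPartial, iteratedFDeriv_one_apply]
  refine ⟨hf, fun x => norm_le_of_abs_basisVec_le _ hC fun i => ?_, fun x y => ?_⟩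
  · have := (supNorm_iteratedPartial_le_holderNorm le_rfl s (fun _ : Fin 1 => i) f).trans h
    rw [supNorm_le_ofReal_iff hC, hpart] at this
    exact this x
  · rw [mul_assoc]
    refine norm_le_of_abs_basisVec_le _ (by positivity) fun i => ?_
    have h1 : eHolderNorm s.toNNReal (iteratedPartial (fun _ : Fin 1 => i) f) ≤ ENNReal.ofReal C :=
      ((le_iSup (fun μ : Fin 1 → Fin n => eHolderNorm s.toNNReal (iteratedPartial μ f)) _).trans
        le_self_add).trans h
    have hmem : MemHolder s.toNNReal (iteratedPartial (fun _ : Fin 1 => i) f) :=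
      eHolderNorm_lt_top.1 (h1.trans_lt ENNReal.ofReal_lt_top)
    have h2 := hmem.holderWith.dist_le x y
    have h3 : (nnHolderNorm s.toNNReal (iteratedPartial (fun _ : Fin 1 => i) f) : ℝ) ≤ C := by
      rw [← hmem.coe_nnHolderNorm_eq_eHolderNorm, ENNReal.ofReal,
        ENNReal.coe_le_coe] at h1
      exact (NNReal.coe_le_coe.2 h1).trans_eq (Real.coe_toNNReal _ hC)
    rw [hpart, Real.dist_eq, Real.coe_toNNReal _ hs, dist_eq_norm] at h2
    exact h2.trans (mul_le_mul_of_nonneg_right (hpart i ▸ h3) (by positivity))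

lemma HasTimeDeriv.mono_of_mem {n : ℕ} {N : (E n → ℝ) → ℝ≥0∞} {I J : Set ℝ} {u : ℝ → E n → ℝ}
    {w : E n → ℝ} {t : ℝ} (h : HasTimeDeriv N I u w t) (hJ : I ∈ 𝓝[J] t) :
    HasTimeDeriv N J u w t := by
  refine h.mono_left (nhdsWithin_le_of_mem ?_)
  exact inter_mem (nhdsWithin_mono _ Set.sdiff_subset hJ)
    (nhdsWithin_mono _ (fun _ hx => hx.2) self_mem_nhdsWithin)

lemma HasTimeDeriv.supNorm {n k : ℕ} {s : ℝ} {I : Set ℝ} {u : ℝ → E n → ℝ}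
    {w : E n → ℝ} {t : ℝ} (h : HasTimeDeriv (holderNorm k s) I u w t) :
    HasTimeDeriv NMCF.supNorm I u w t :=
  tendsto_of_tendsto_of_tendsto_of_le_of_le tendsto_const_nhds h (fun _ => zero_le)
    fun _ => supNorm_le_holderNorm _ _ _

lemma HasTimeDeriv.hasDerivWithinAt {n : ℕ} {I : Set ℝ} {u : ℝ → E n → ℝ}
    {w : E n → ℝ} {t : ℝ} (h : HasTimeDeriv NMCF.supNorm I u w t) (x : E n) :
    HasDerivWithinAt (fun r => u r x) (w x) I t := by
  rw [hasDerivWithinAt_iff_tendsto_slope, Metric.tendsto_nhds]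
  intro ε hε
  filter_upwards [tendsto_supNorm_iff.1 h (ε / 2) (half_pos hε)] with r hr
  have := hr x
  rw [Real.dist_eq]
  simp only [slope, vsub_eq_sub, Pi.sub_apply, Pi.smul_apply] at this ⊢
  linarith

lemma ContinuousInto.continuousOn {n k : ℕ} {s : ℝ} {I : Set ℝ} {u : ℝ → E n → ℝ}
    (h : ContinuousInto k s I u) :
    ContinuousOn (fun p : ℝ × E n => u p.1 p.2) (I ×ˢ Set.univ) := by
  rintro ⟨t, x⟩ ⟨ht, -⟩
  have h1 : Tendsto (fun r => supNorm (u r - u t)) (𝓝[I] t) (𝓝 0) :=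
    tendsto_of_tendsto_of_tendsto_of_le_of_le tendsto_const_nhds (h.2 t ht) (fun _ => zero_le)
      fun _ => supNorm_le_holderNorm _ _ _
  have h2 : Continuous (u t) := (h.1 t ht).1.2.1.continuous
  rw [ContinuousWithinAt, Metric.tendsto_nhds]
  intro ε hε
  rw [nhdsWithin_prod_eq, nhdsWithin_univ]
  have h3 := (tendsto_supNorm_iff.1 h1 (ε / 2) (half_pos hε)).prod_mk
    (Metric.tendsto_nhds.1 (h2.tendsto x) (ε / 2) (half_pos hε))
  filter_upwards [h3] with p hp
  have h4 := hp.1 p.2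
  have h5 := hp.2
  rw [Real.dist_eq] at h5 ⊢
  calc |u p.1 p.2 - u t x| ≤ |u p.1 p.2 - u t p.2| + |u t p.2 - u t x| := abs_sub_le _ _ _
    _ < ε := by simp only [Pi.sub_apply] at h4; linarith

lemma exists_holderBound_of_mem_littleHolder {n : ℕ} {s : ℝ} (hs : 0 ≤ s) {f : E n → ℝ}
    (hf : f ∈ littleHolder n 1 s) : ∃ M, HolderBound s M f :=
  ⟨_, holderBound_of_holderNorm_le hs ENNReal.toReal_nonneg (mod_cast hf.1.2.1)
    (ENNReal.ofReal_toReal hf.1.2.2.ne).ge⟩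

lemma timeIco_subset {T : EReal} {τ : ℝ} (hτ : τ ∈ timeIco T) : Set.Icc 0 τ ⊆ timeIco T :=
  fun _ hr => ⟨hr.1, (EReal.coe_le_coe_iff.2 hr.2).trans_lt hτ.2⟩

lemma isOpen_timeIoo (T : EReal) : IsOpen (timeIoo T) :=
  isOpen_Ioi.inter (isOpen_Iio.preimage continuous_coe_real_ereal)

lemma IsSolution.hasTimeDeriv {n : ℕ} {α β γ : ℝ} {u₀ : E n → ℝ} {T : EReal}
    {u : ℝ → E n → ℝ} (hu : IsSolution α β γ u₀ T u) {t : ℝ} (ht : t ∈ timeIoo T) (J : Set ℝ) :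
    HasTimeDeriv NMCF.supNorm J u (Phi α (u t) (u t)) t := by
  obtain ⟨w, hw, hwΦ⟩ := hu.equation
  rw [← hwΦ t ht]
  exact (hw.2.2 t ht).supNorm.mono_of_mem
    (mem_nhdsWithin_of_mem_nhds ((isOpen_timeIoo T).mem_nhds ht))

lemma IsSolution.isClassicalFlow {n : ℕ} {α β γ : ℝ} (hγ : 0 ≤ γ) {u₀ : E n → ℝ} {T : EReal}
    {u : ℝ → E n → ℝ} (hu : IsSolution α β γ u₀ T u) {τ : ℝ} (hτ : τ ∈ timeIco T) :
    IsClassicalFlow α γ τ u where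
  continuousOn := hu.continuous_zero.continuousOn.mono (Set.prod_mono_left (timeIco_subset hτ))
  periodic _ ht := (hu.continuous_zero.1 _ (timeIco_subset hτ ht)).1.1
  holderBound _ ht := exists_holderBound_of_mem_littleHolder hγ
    (hu.continuous_pos.1 _ ⟨ht.1, (timeIco_subset hτ ⟨ht.1.le, ht.2⟩).2⟩)
  hasDerivWithinAt _ ht x := (hu.hasTimeDeriv
    ⟨ht.1, (timeIco_subset hτ ⟨ht.1.le, ht.2⟩).2⟩ _).hasDerivWithinAt x

/-! ### Lipschitz dependence of Φ(u)[u] on u -/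

lemma abs_one_add_sq_rpow_sub_le {p : ℝ} (hp : 0 ≤ p) (a b : ℝ) :
    |(1 + b ^ 2) ^ (-p) - (1 + a ^ 2) ^ (-p)| ≤ p * |b - a| := by
  have hder : ∀ q : ℝ, HasDerivAt (fun q : ℝ => (1 + q ^ 2) ^ (-p))
      (2 * q * (-p) * (1 + q ^ 2) ^ (-p - 1)) q := by
    intro q
    have h1 : HasDerivAt (fun q : ℝ => 1 + q ^ 2) (2 * q) q := by
      simpa using ((hasDerivAt_id q).pow 2).const_add 1
    exact h1.rpow_const (Or.inl (by positivity))
  have := (convex_univ (𝕜 := ℝ) (E := ℝ)).norm_image_sub_le_of_norm_hasDerivWithin_le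
    (C := p) (fun q _ => (hder q).hasDerivWithinAt) (fun q _ => ?_)
    (Set.mem_univ a) (Set.mem_univ b)
  · simpa using this
  · have hq : 0 < 1 + q ^ 2 := by positivity
    -- This absorbs the factor 2q into one power of 1 + q², leaving a derivative bounded by p.
    have h1 : |2 * q| ≤ 1 + q ^ 2 := by
      rw [abs_le]; constructor <;> nlinarith [sq_nonneg (q - 1), sq_nonneg (q + 1)]
    have h2 : (1 + q ^ 2) ^ (-p) ≤ 1 :=
      Real.rpow_le_one_of_one_le_of_nonpos (by nlinarith [sq_nonneg q]) (by linarith)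
    rw [Real.norm_eq_abs, abs_mul, abs_mul, abs_neg, abs_of_nonneg hp,
      abs_of_nonneg (by positivity : (0 : ℝ) ≤ (1 + q ^ 2) ^ (-p - 1))]
    calc _ ≤ (1 + q ^ 2) * p * (1 + q ^ 2) ^ (-p - 1) := by gcongr
      _ = p * (1 + q ^ 2) ^ (-p) := by
        rw [Real.rpow_sub hq, Real.rpow_one]; field_simp
      _ ≤ p := mul_le_of_le_one_right hp h2

section Lipschitz

variable {n : ℕ} {s α M M' : ℝ} {u v : E n → ℝ}

lemma inv_denom_eq (α : ℝ) (u : E n → ℝ) (x : E n) {y : E n} (hy : y ≠ 0) :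
    (denom α u x y)⁻¹ = (‖y‖ ^ ((n : ℝ) + 1 + α))⁻¹ *
      (1 + ((u x - u (x - y)) / ‖y‖) ^ 2) ^ (-(((n : ℝ) + 1 + α) / 2)) := by
  have hy' : 0 < ‖y‖ := norm_pos_iff.2 hy
  have h2 : ‖y‖ ^ 2 + (u x - u (x - y)) ^ 2 =
      ‖y‖ ^ (2 : ℝ) * (1 + ((u x - u (x - y)) / ‖y‖) ^ 2) := by
    rw [Real.rpow_two]; field_simp
  rw [denom, h2, Real.mul_rpow (by positivity) (by positivity), ← Real.rpow_mul hy'.le, mul_inv,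
    Real.rpow_neg (by positivity)]
  congr 3; ring

/-- Once the power of ‖y‖ is factored out, the denominators depend only on difference quotients,
which differ by at most M'. -/
lemma abs_inv_denom_sub_le (hα : 0 ≤ α) (hd : HolderBound s M' (u - v)) (x : E n) {y : E n}
    (hy : y ≠ 0) : |(denom α u x y)⁻¹ - (denom α v x y)⁻¹| ≤
      ((n : ℝ) + 1 + α) / 2 * M' * (‖y‖ ^ ((n : ℝ) + 1 + α))⁻¹ := by
  have hy' : 0 < ‖y‖ := norm_pos_iff.2 hy
  rw [inv_denom_eq α u x hy, inv_denom_eq α v x hy, ← mul_sub, abs_mul,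
    abs_of_nonneg (by positivity), mul_comm]
  refine mul_le_mul_of_nonneg_right ?_ (by positivity)
  refine (abs_one_add_sq_rpow_sub_le (by positivity) _ _).trans ?_
  refine mul_le_mul_of_nonneg_left ?_ (by positivity)
  have h := hd.abs_sub_le (x - y) x
  rw [sub_sub_cancel] at h
  rw [← sub_div, abs_div, abs_of_pos hy', div_le_iff₀ hy']
  refine le_of_eq_of_le ?_ h
  simp only [Pi.sub_apply]
  congr 1; ring

lemma numer_sub (hu : Differentiable ℝ u) (hv : Differentiable ℝ v) (x y : E n) :
    numer (u - v) x y = numer u x y - numer v x y := by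
  simp only [numer, inner_gradient_eq, fderiv_sub (hu _) (hv _), Pi.sub_apply, sub_apply]
  ring

lemma abs_integrand_sub_le (hα : 0 ≤ α) (hs : 0 ≤ s) (hu : HolderBound s M u)
    (hv : HolderBound s M v) (hd : HolderBound s M' (u - v)) (x y : E n) :
    |numer u x y / denom α u x y - numer v x y / denom α v x y| ≤
      (2 * M' + 2 * M * (((n : ℝ) + 1 + α) / 2 * M')) * majorant n s α ‖y‖ := by
  have hM := hu.nonneg
  have hM' := hd.nonneg
  have hmaj : 0 ≤ majorant n s α ‖y‖ := by unfold majorant; positivity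
  rcases eq_or_ne y 0 with rfl | hy
  · have h0 : ∀ w : E n → ℝ, numer w x 0 = 0 := fun w => by simp [numer]
    rw [h0, h0, zero_div, zero_div, sub_zero, abs_zero]
    positivity
  have h1 := abs_numer_div_denom_le (u := u) hα hs hd x y
  have h2 := abs_inv_denom_sub_le hα hd x hy
  have h3 := abs_numer_le hs hv x y
  have h4 : |numer v x y * ((denom α u x y)⁻¹ - (denom α v x y)⁻¹)| ≤
      2 * M * (((n : ℝ) + 1 + α) / 2 * M') * majorant n s α ‖y‖ := by
    rw [abs_mul]
    refine (mul_le_mul h3 h2 (abs_nonneg _) ((abs_nonneg _).trans h3)).trans_eq ?_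
    rw [majorant]; ring
  -- The numerator is linear, so the difference splits into a change of numerator and a change of
  -- denominator, each proportional to M'.
  have h5 : numer u x y / denom α u x y - numer v x y / denom α v x y =
      numer (u - v) x y / denom α u x y +
        numer v x y * ((denom α u x y)⁻¹ - (denom α v x y)⁻¹) := by
    rw [numer_sub hu.differentiable hv.differentiable]; ring
  rw [h5]
  refine (abs_add_le _ _).trans ?_
  linarith

lemma abs_sqrt_one_add_sq_sub_le (a b : ℝ) :
    |Real.sqrt (1 + a ^ 2) - Real.sqrt (1 + b ^ 2)| ≤ |a - b| := by
  -- √(1 + a²) = |1 + ia|, so the claim is the reverse triangle inequality in ℂ.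
  have hmem : ∀ a : ℝ, Real.sqrt (1 + a ^ 2) = ‖(⟨1, a⟩ : ℂ)‖ := fun a => by
    rw [Complex.norm_def, Complex.normSq_mk]; congr 1; ring
  rw [hmem, hmem]
  refine (abs_norm_sub_norm_le _ _).trans_eq ?_
  rw [Complex.norm_def, Complex.normSq_apply]
  simp [Real.sqrt_mul_self_eq_abs]

/-- The operator is Lipschitz continuous on bounded sets of `C^{1+s}`, `s > α`, with values in
the bounded functions. -/
lemma abs_Phi_sub_le (hn : 1 ≤ n) (hα : 0 < α) (hs : α < s) (hu : HolderBound s M u)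
    (hv : HolderBound s M v) (hd : HolderBound s M' (u - v)) (x : E n) :
    |Phi α u u x - Phi α v v x| ≤ 2 / α * (2 * M + (1 + M) * (2 + M * ((n : ℝ) + 1 + α))) *
      (∫ y : E n, majorant n s α ‖y‖) * M' := by
  have hM := hu.nonneg
  have hM' := hd.nonneg
  set J := ∫ y : E n, majorant n s α ‖y‖
  have hJ : 0 ≤ J := integral_nonneg fun y => by
    simp only [Pi.zero_apply, majorant]; positivity
  have hmaj := integrable_majorant hn hα hs
  have hIu := integrable_numer_div_denom hn hα hs hu.contDiff.continuous hu x
  have hIv := integrable_numer_div_denom hn hα hs hv.contDiff.continuous hv x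
  set Iu := ∫ y, numer u x y / denom α u x y with hIu'
  set Iv := ∫ y, numer v x y / denom α v x y with hIv'
  have h1 : |Iu| ≤ 2 * M * J := by
    have := norm_integral_le_of_norm_le (f := fun y => numer u x y / denom α u x y)
      (hmaj.const_mul (2 * M)) (Eventually.of_forall fun y =>
        abs_numer_div_denom_le hα.le (hα.trans hs).le hu x y)
    rwa [integral_const_mul, Real.norm_eq_abs] at this
  have h2 : |Iu - Iv| ≤ (2 * M' + 2 * M * (((n : ℝ) + 1 + α) / 2 * M')) * J := by
    have := norm_integral_le_of_norm_le
      (f := fun y => numer u x y / denom α u x y - numer v x y / denom α v x y)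
      (hmaj.const_mul (2 * M' + 2 * M * (((n : ℝ) + 1 + α) / 2 * M')))
      (Eventually.of_forall fun y =>
        abs_integrand_sub_le hα.le (hα.trans hs).le hu hv hd x y)
    rwa [integral_const_mul, integral_sub hIu hIv, Real.norm_eq_abs] at this
  set a := Real.sqrt (1 + ‖gradient u x‖ ^ 2) with ha
  set b := Real.sqrt (1 + ‖gradient v x‖ ^ 2) with hb
  have h3 : |a - b| ≤ M' := by
    refine (abs_sqrt_one_add_sq_sub_le _ _).trans ?_
    rw [norm_gradient_eq, norm_gradient_eq]
    refine (abs_norm_sub_norm_le _ _).trans ?_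
    rw [← fderiv_sub (hu.differentiable x) (hv.differentiable x)]
    exact hd.norm_le x
  have h4 : |b| ≤ 1 + M := by
    rw [hb, abs_of_nonneg (Real.sqrt_nonneg _), norm_gradient_eq]
    refine Real.sqrt_le_iff.2 ⟨by positivity, ?_⟩
    have := hv.norm_le x
    nlinarith [norm_nonneg (fderiv ℝ v x)]
  have h5 : Phi α u u x - Phi α v v x = 2 / α * ((a - b) * Iu + b * (Iu - Iv)) := by
    rw [Phi_eq, Phi_eq, ← ha, ← hb, ← hIu', ← hIv']; ring
  have h6 : |(a - b) * Iu + b * (Iu - Iv)| ≤ M' * (2 * M * J) +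
      (1 + M) * ((2 * M' + 2 * M * (((n : ℝ) + 1 + α) / 2 * M')) * J) := by
    refine (abs_add_le _ _).trans ?_
    rw [abs_mul, abs_mul]
    gcongr
  rw [h5, abs_mul, abs_of_pos (by positivity)]
  refine (mul_le_mul_of_nonneg_left h6 (by positivity)).trans_eq ?_
  ring

end Lipschitz

lemma tendsto_supNorm_Phi_sub {n : ℕ} (hn : 1 ≤ n) {α s : ℝ} (hα : 0 < α) (hs : α < s)
    {I : Set ℝ} {u : ℝ → E n → ℝ} (hu : ContinuousInto 1 s I u) {t : ℝ} (ht : t ∈ I) :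
    Tendsto (fun r => supNorm (Phi α (u r) (u r) - Phi α (u t) (u t))) (𝓝[I] t) (𝓝 0) := by
  have hs0 : 0 ≤ s := (hα.trans hs).le
  obtain ⟨M, hM⟩ := exists_holderBound_of_mem_littleHolder hs0 (hu.1 t ht)
  rw [tendsto_supNorm_iff]
  intro ε hε
  set A : ℝ := 2 / α * (2 * (M + n) + (1 + (M + n)) * (2 + (M + n) * ((n : ℝ) + 1 + α))) *
      (∫ y : E n, majorant n s α ‖y‖) with hA
  have hA0 : 0 ≤ A := by
    have := hM.nonneg
    have hJ : 0 ≤ ∫ y : E n, majorant n s α ‖y‖ := integral_nonneg fun y => by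
      simp only [Pi.zero_apply, majorant]; positivity
    positivity
  -- η ≤ 1 keeps u(r) within the bound M + n for which A was computed; the +1 in the denominator
  -- avoids having to show A > 0.
  set η : ℝ := min 1 (ε / (A * n + 1))
  have hη : 0 < η := lt_min one_pos (by positivity)
  filter_upwards [ENNReal.tendsto_nhds_zero.1 (hu.2 t ht) _ (ENNReal.ofReal_pos.2 hη),
    self_mem_nhdsWithin] with r hr hrI x
  have hc : ∀ r ∈ I, ContDiff ℝ 1 (u r) := fun r hr => mod_cast (hu.1 r hr).1.2.1
  have hd : HolderBound s (n * η) (u r - u t) := holderBound_of_holderNorm_le hs0 hη.le ((hc r hrI).sub (hc t ht)) hr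
  have hnη : n * η ≤ n := mul_le_of_le_one_right (by positivity) (min_le_left _ _)
  have hur : HolderBound s (M + n) (u r) := by
    have h1 := (hM.add hd).mono (add_le_add_right hnη M)
    rwa [add_sub_cancel] at h1
  refine (abs_Phi_sub_le hn hα hs hur (hM.mono (by simp)) hd x).trans ?_
  rw [← hA]
  calc A * (n * η) ≤ (A * n + 1) * η := by nlinarith
    _ ≤ (A * n + 1) * (ε / (A * n + 1)) := by gcongr; exact min_le_right _ _
    _ = ε := by field_simp

/-! ### The three estimates for solutions -/

section Solution

variable {n : ℕ} {α β γ : ℝ} {u₀ : E n → ℝ} {T : EReal} {u : ℝ → E n → ℝ}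

lemma IsSolution.zero_mem (hu : IsSolution α β γ u₀ T u) : 0 ∈ timeIco T :=
  ⟨le_rfl, by simpa using hu.pos⟩

lemma IsSolution.supNorm_le (hn : 1 ≤ n) (hα : 0 < α) (hγ : α < γ)
    (hu : IsSolution α β γ u₀ T u) {t : ℝ} (ht : t ∈ timeIco T) :
    supNorm (u t) ≤ supNorm u₀ := by
  refine supNorm_le_supNorm fun C hC h x => ?_
  have hflow := hu.isClassicalFlow (hα.trans hγ).le ht
  have h0 := isClassicalFlow_zero (n := n) α γ t
  have htt : t ∈ Set.Icc 0 t := ⟨ht.1, le_rfl⟩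
  have h1 := hflow.sub_le hn hα hγ h0 (C := C)
    (fun x => by rw [hu.initial]; linarith [(abs_le.1 (h x)).2]) htt x
  have h2 := h0.sub_le hn hα hγ hflow (C := C)
    (fun x => by rw [hu.initial]; linarith [(abs_le.1 (h x)).1]) htt x
  exact abs_le.2 ⟨by linarith, by linarith⟩

lemma hasDerivAt_comp_add_smul {f : E n → ℝ} (hf : Differentiable ℝ f) (x e : E n) (r : ℝ) :
    HasDerivAt (fun r : ℝ => f (x + r • e)) (fderiv ℝ f (x + r • e) e) r := by
  have h1 : HasDerivAt (fun r : ℝ => x + r • e) e r := by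
    simpa using ((hasDerivAt_id r).smul_const e).const_add x
  exact (hf _).hasFDerivAt.comp_hasDerivAt r h1

lemma IsSolution.supNorm_partialDeriv_le (hn : 1 ≤ n) (hα : 0 < α) (hγ : α < γ)
    (hu : IsSolution α β γ u₀ T u) (hu₀ : Differentiable ℝ u₀) {t : ℝ} (ht : t ∈ timeIco T)
    (i : Fin n) : supNorm (partialDeriv i (u t)) ≤ supNorm (partialDeriv i u₀) := by
  refine supNorm_le_supNorm fun C hC h x => ?_
  have hflow := hu.isClassicalFlow (hα.trans hγ).le ht
  have htt : t ∈ Set.Icc 0 t := ⟨ht.1, le_rfl⟩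
  have hlip₀ : ∀ (r : ℝ) (z : E n), |u₀ (z + r • basisVec i) - u₀ z| ≤ C * |r| := by
    intro r z
    have := (convex_univ (𝕜 := ℝ) (E := ℝ)).norm_image_sub_le_of_norm_hasDerivWithin_le (C := C)
      (fun r _ => (hasDerivAt_comp_add_smul hu₀ z (basisVec i) r).hasDerivWithinAt)
      (fun r _ => h _) (Set.mem_univ 0) (Set.mem_univ r)
    simpa using this
  -- Comparing u with its translate, in both orders, propagates the Lipschitz constant C in
  -- direction i.
  have hlip : ∀ r : ℝ, |u t (x + r • basisVec i) - u t x| ≤ C * |r| := by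
    intro r
    have hr := hflow.space_translate (r • basisVec i)
    have h1 := hr.sub_le hn hα hγ hflow (C := C * |r|)
      (fun z => by rw [hu.initial]; exact (le_abs_self _).trans (hlip₀ r z)) htt x
    have h2 := hflow.sub_le hn hα hγ hr (C := C * |r|)
      (fun z => by rw [hu.initial]; linarith [(abs_le.1 (hlip₀ r z)).1]) htt x
    exact abs_le.2 ⟨by linarith, by linarith⟩
  have hdiff : Differentiable ℝ (u t) :=
    (hu.continuous_zero.1 t ht).1.2.1.differentiable (by norm_num)
  have hder := hasDerivAt_comp_add_smul hdiff x (basisVec i) 0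
  rw [zero_smul, add_zero] at hder
  refine hder.le_of_lip' hC (Eventually.of_forall fun r => ?_)
  simpa using hlip r

/-- If `β > α`, the flow is differentiable in time up to the time `0`. -/
lemma IsSolution.hasTimeDeriv_zero (hn : 1 ≤ n) (hα : 0 < α) (hγ : α < γ) (hβ : α < β)
    (hu : IsSolution α β γ u₀ T u) :
    HasTimeDeriv supNorm (timeIco T) u (Phi α (u 0) (u 0)) 0 := by
  have h0 := hu.zero_mem
  rw [HasTimeDeriv, tendsto_supNorm_iff]
  intro ε hε
  have h1 := tendsto_supNorm_iff.1
    (tendsto_supNorm_Phi_sub hn hα hβ hu.continuous_zero h0) ε hε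
  obtain ⟨δ, hδ, h2⟩ := Metric.mem_nhdsWithin_iff.1 h1
  filter_upwards [inter_mem_nhdsWithin _ (Metric.ball_mem_nhds (0 : ℝ) hδ)] with r hr x
  have hrT : r ∈ timeIco T := hr.1.1
  have hr0 : 0 < r := lt_of_le_of_ne hrT.1 (Ne.symm hr.1.2)
  have hrδ : r < δ := by simpa [abs_of_pos hr0] using hr.2
  have hflow := hu.isClassicalFlow (hα.trans hγ).le hrT
  -- For fixed x the difference quotient equals Φ(u(c))[u(c)](x) for some c in (0, r). Although c
  -- depends on x, δ does not, so the convergence is uniform.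
  obtain ⟨c, hc, hslope⟩ := exists_hasDerivAt_eq_slope (fun s => u s x)
    (fun s => Phi α (u s) (u s) x) hr0
    (hflow.continuousOn.comp (f := fun s : ℝ => (s, x)) (by fun_prop) fun s hs => ⟨hs, trivial⟩)
    (fun s hs => by
      have hs' : s ∈ timeIoo T := ⟨hs.1, (timeIco_subset hrT ⟨hs.1.le, hs.2.le⟩).2⟩
      exact ((hu.hasTimeDeriv hs' (timeIoo T)).hasDerivWithinAt x).hasDerivAt
        ((isOpen_timeIoo T).mem_nhds hs'))
  have hcT : c ∈ timeIco T := timeIco_subset hrT ⟨hc.1.le, hc.2.le⟩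
  have h3 := h2 ⟨by simpa [abs_of_pos hc.1] using hc.2.trans hrδ, hcT⟩ x
  simp only [Pi.sub_apply, Pi.smul_apply, smul_eq_mul, sub_zero] at h3 hslope ⊢
  rwa [← div_eq_inv_mul, ← hslope]

lemma IsSolution.hasTimeDeriv_timeIco (hn : 1 ≤ n) (hα : 0 < α) (hγ : α < γ) (hβ : α < β)
    (hu : IsSolution α β γ u₀ T u) {t : ℝ} (ht : t ∈ timeIco T) :
    HasTimeDeriv supNorm (timeIco T) u (Phi α (u t) (u t)) t := by
  rcases ht.1.eq_or_lt with rfl | hpos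
  · exact hu.hasTimeDeriv_zero hn hα hγ hβ
  · exact hu.hasTimeDeriv ⟨hpos, ht.2⟩ _

/-- The shift u(· + h) is again a flow, and it differs from u at time 0 by at most (C + ε)h.
Comparison carries this bound to time t; dividing by h and letting h decrease to 0 gives C + ε. -/
lemma IsSolution.supNorm_Phi_le (hn : 1 ≤ n) (hα : 0 < α) (hγ : α < γ) (hβ : α < β)
    (hu : IsSolution α β γ u₀ T u) {t : ℝ} (ht : t ∈ timeIco T) :
    supNorm (Phi α (u t) (u t)) ≤ supNorm (Phi α (u 0) (u 0)) := by
  refine supNorm_le_supNorm fun C hC h x => le_of_forall_pos_le_add fun ε hε => ?_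
  have hder := (hu.hasTimeDeriv_timeIco hn hα hγ hβ ht).hasDerivWithinAt x
  obtain ⟨b, hb, hbT⟩ : ∃ b : ℝ, t < b ∧ (b : EReal) < T := by
    obtain ⟨b, hb⟩ := EReal.lt_iff_exists_real_btwn.1 ht.2
    exact ⟨b, EReal.coe_lt_coe_iff.1 hb.1, hb.2⟩
  have hmem : ∀ h ∈ Set.Ioo 0 (b - t), t + h ∈ timeIco T := fun h hh =>
    ⟨add_nonneg ht.1 hh.1.le, (EReal.coe_lt_coe_iff.2 (by linarith [hh.2])).trans hbT⟩
  have hIoo : Set.Ioo 0 (b - t) ∈ 𝓝[>] (0 : ℝ) := Ioo_mem_nhdsGT (by linarith)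
  have htend : Tendsto (fun h : ℝ => h⁻¹ * (u (t + h) x - u t x)) (𝓝[>] 0)
      (𝓝 (Phi α (u t) (u t) x)) := by
    have h1 := hasDerivWithinAt_iff_tendsto_slope.1 hder
    have h2 : Tendsto (fun h : ℝ => t + h) (𝓝[>] 0) (𝓝[timeIco T \ {t}] t) := by
      refine tendsto_nhdsWithin_iff.2 ⟨?_, ?_⟩
      · have : Tendsto (fun h : ℝ => t + h) (𝓝 0) (𝓝 (t + 0)) := by
          apply Continuous.tendsto; fun_prop
        rw [add_zero] at this
        exact this.mono_left nhdsWithin_le_nhds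
      · filter_upwards [hIoo] with h hh
        exact ⟨hmem h hh, by simpa using hh.1.ne'⟩
    refine (h1.comp h2).congr fun h => ?_
    simp [slope]
  -- Uniformity in z is essential, since comparison needs the initial bound at every point.
  have hzero : ∀ᶠ h in 𝓝[>] (0 : ℝ), ∀ z, |h⁻¹ * (u h z - u 0 z) - Phi α (u 0) (u 0) z| ≤ ε := by
    have h1 := tendsto_supNorm_iff.1 (hu.hasTimeDeriv_zero hn hα hγ hβ) ε hε
    have h2 : 𝓝[>] (0 : ℝ) ≤ 𝓝[timeIco T \ {0}] 0 := by
      refine nhdsWithin_le_of_mem ?_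
      filter_upwards [hIoo] with h hh
      refine ⟨⟨hh.1.le, ?_⟩, hh.1.ne'⟩
      exact (EReal.coe_le_coe_iff.2 (by linarith [ht.1])).trans_lt (hmem h hh).2
    filter_upwards [h2 h1] with h hh z
    simpa using hh z
  refine le_of_tendsto htend.abs ?_
  filter_upwards [hzero, hIoo] with h hh hhI
  have hpos : 0 < h := hhI.1
  have hinit : ∀ z, |u h z - u 0 z| ≤ (C + ε) * h := by
    intro z
    have h1 : |h⁻¹ * (u h z - u 0 z)| ≤ C + ε := by
      have h2 := abs_add_le (h⁻¹ * (u h z - u 0 z) - Phi α (u 0) (u 0) z) (Phi α (u 0) (u 0) z)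
      rw [sub_add_cancel] at h2
      linarith [hh z, ‹∀ z, |Phi α (u 0) (u 0) z| ≤ C› z]
    rwa [abs_mul, abs_inv, abs_of_pos hpos, inv_mul_le_iff₀ hpos, mul_comm h] at h1
  have hflow := hu.isClassicalFlow (hα.trans hγ).le (hmem h hhI)
  have hflow' := hflow.mono (τ' := t) (by linarith)
  have hshift := hflow.time_translate hpos.le
  have htt : t ∈ Set.Icc 0 t := ⟨ht.1, le_rfl⟩
  have h1 := hshift.sub_le hn hα hγ hflow' (C := (C + ε) * h)
    (fun z => by rw [zero_add]; exact (le_abs_self _).trans (hinit z)) htt x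
  have h2 := hflow'.sub_le hn hα hγ hshift (C := (C + ε) * h)
    (fun z => by rw [zero_add]; linarith [(abs_le.1 (hinit z)).1]) htt x
  rw [abs_mul, abs_inv, abs_of_pos hpos, inv_mul_le_iff₀ hpos, mul_comm h]
  exact abs_le.2 ⟨by linarith, by linarith⟩

end Solution

end NMCF

end

theorem lemma4p3 (n : ℕ) (hn : 1 ≤ n) (α β γ : ℝ)
    (hα : α ∈ Set.Ioo (0 : ℝ) 1) (hβ : β ∈ Set.Ioo (0 : ℝ) 1)
    (hγ : max α β < γ) (hγ' : γ < min 1 (α + β))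
    (u₀ : NMCF.E n → ℝ) (hu₀ : u₀ ∈ NMCF.littleHolder n 1 β)
    (T : EReal) (u : ℝ → NMCF.E n → ℝ) (hu : NMCF.IsMaximalSolution α β γ u₀ T u) :
    (∀ t ∈ NMCF.timeIco T, NMCF.supNorm (u t) ≤ NMCF.supNorm u₀) ∧
    (∀ t ∈ NMCF.timeIco T, ∀ i : Fin n,
      NMCF.supNorm (NMCF.partialDeriv i (u t)) ≤ NMCF.supNorm (NMCF.partialDeriv i u₀)) ∧
    (α < β → ∃ w : ℝ → NMCF.E n → ℝ,
      (∀ t ∈ NMCF.timeIco T, NMCF.HasTimeDeriv NMCF.supNorm (NMCF.timeIco T) u (w t) t) ∧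
      ∀ t ∈ NMCF.timeIco T, NMCF.supNorm (w t) ≤ NMCF.supNorm (w 0)) := by
  have hs := hu.isSolution
  have hαγ : α < γ := (le_max_left _ _).trans_lt hγ
  refine ⟨fun t ht => hs.supNorm_le hn hα.1 hαγ ht, fun t ht i =>
    hs.supNorm_partialDeriv_le hn hα.1 hαγ (hu₀.1.2.1.differentiable (by norm_num)) ht i,
    fun hαβ => ⟨fun t => NMCF.Phi α (u t) (u t), fun t ht =>
      hs.hasTimeDeriv_timeIco hn hα.1 hαγ hαβ ht, fun t ht =>
      hs.supNorm_Phi_le hn hα.1 hαγ hαβ ht⟩⟩
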